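/- Let $2<p<\infty$, let $\mu$ be an arbitrary measure, let $X$ be a closed linear subspace of (real or complex) $L_p(\mu)$, and let $\aleph$ be an uncountable cardinal. For an infinite cardinal $\kappa$, call a Banach space an $L_p(\kappa)$ space if it is isometrically isomorphic to an $\ell_p$-sum $\bigl(\sum_{\alpha\in\Gamma}L_p(\mu_\alpha)\bigr)_p$ with $|\Gamma|\le\kappa$ and every $\mu_\alpha$ a finite measure. The following are equivalent: 1. $\ell_p(\aleph)$ embeds isometrically (by a linear map) into $X$. 2. There is a subspace of $X$ that is isomorphic (linearly homeomorphic) to $\ell_p(\aleph)$ and is complemented in $L_p(\mu)$, that is, is the range of a bounded linear projection on $L_p(\mu)$. 3. $\ell_p(\aleph)$ embeds isomorphically into $X$, that is, there are a bounded linear operator $T\colon\ell_p(\aleph)\to X$ and a constant $c>0$ with $\|Tx\|\ge c\|x\|$ for all $x$. 4. There is no one-to-one bounded linear operator from $X$ into an $L_p(\kappa)$ space with $\kappa$ an infinite cardinal and $\kappa<\aleph$. -/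

import Mathlib

open MeasureTheory
open scoped ENNReal Cardinal

universe u

/-- A normed space `Y` over `𝕜` is an *`L_p(κ)` space* if it is isometrically isomorphic to the
`ℓ_p`-sum `(∑_{a ∈ A} L_p(μ_a))_p` of a family of spaces `L_p(μ_a)`, indexed by a set `A` of
cardinality at most `κ`, with every `μ_a` a finite measure. -/
def IsLpCardSpace (𝕜 : Type*) [RCLike 𝕜] (p : ℝ≥0∞) [Fact (1 ≤ p)] (κ : Cardinal.{u})
    (Y : Type*) [NormedAddCommGroup Y] [NormedSpace 𝕜 Y] : Prop :=
  ∃ (A : Type u) (Ω : A → Type u) (m : ∀ a, MeasurableSpace (Ω a))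
    (μ : ∀ a, @Measure (Ω a) (m a)),
    #A ≤ κ ∧ (∀ a, IsFiniteMeasure (μ a)) ∧
      Nonempty (Y ≃ₗᵢ[𝕜] lp (fun a => Lp 𝕜 p (μ a)) p)

/-! ### Disjointly supported functions in `L_p(μ)` -/

/-! The substance is 3 → 4 and 4 → 1, 2. For 4 → 1, 2, take by Zorn a maximal family of normalized,
pairwise disjointly supported elements of `X`. If it had fewer than `#ι` members, restriction to
their supports, cut into level sets of finite measure, would map `L_p(μ)` into an `L_p(κ)` space
with `κ < #ι`. By maximality no nonzero element of `X` is killed, contradicting 4. So there are `#ι`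
disjoint unit functions in `X`; they span an isometric `ℓ_p(ι)`, complemented through norming
functionals on the supports. For 3 → 4, an injection of `ℓ_p(ι)` into an `L_p(κ)` space has at most
`κ` components, each of which can be followed by the inclusion `L_p ⊂ L_2` of a finite measure. As
`p > 2`, an operator from `ℓ_p(ι)` to a Hilbert space kills all but countably many unit vectors, so
if `κ < #ι` some unit vector is killed by every component. -/

lemma enorm_sum_rpow_of_disjoint {ι E : Type*} [NormedAddCommGroup E] {r : ℝ} (hr : 0 < r)
    (s : Finset ι) (v : ι → E) (hv : ∀ i ∈ s, ∀ j ∈ s, i ≠ j → v i = 0 ∨ v j = 0) :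
    ‖∑ i ∈ s, v i‖ₑ ^ r = ∑ i ∈ s, ‖v i‖ₑ ^ r := by
  by_cases h : ∃ i ∈ s, v i ≠ 0
  · obtain ⟨i, hi, hvi⟩ := h
    have hz : ∀ j ∈ s, j ≠ i → v j = 0 := fun j hj hji =>
      (hv i hi j hj hji.symm).resolve_left hvi
    rw [Finset.sum_eq_single_of_mem i hi hz, Finset.sum_eq_single_of_mem i hi]
    intro j hj hji
    simp [hz j hj hji, hr]
  · push Not at h
    rw [Finset.sum_eq_zero h, Finset.sum_eq_zero fun i hi => by simp [h i hi, hr]]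
    simp [hr]

namespace MeasureTheory.Lp

variable {Ω : Type*} [MeasurableSpace Ω] {μ : Measure Ω} {p : ℝ≥0∞}

lemma enorm_rpow_eq_lintegral {E : Type*} [NormedAddCommGroup E] (h0 : p ≠ 0) (hp : p ≠ ∞)
    (g : Lp E p μ) : ‖g‖ₑ ^ p.toReal = ∫⁻ x, ‖g x‖ₑ ^ p.toReal ∂μ := by
  rw [Lp.enorm_def, eLpNorm_eq_lintegral_rpow_enorm_toReal h0 hp, ← ENNReal.rpow_mul, one_div,
    inv_mul_cancel₀ (ENNReal.toReal_pos h0 hp).ne', ENNReal.rpow_one]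

lemma norm_sum_smul_rpow_of_aedisjoint {𝕜 ι : Type*} [RCLike 𝕜] [Fact (1 ≤ p)] (h0 : p ≠ 0)
    (hp : p ≠ ∞) (f : ι → Lp 𝕜 p μ) (hf : ∀ i, ‖f i‖ = 1)
    (hd : Pairwise fun i j => AEDisjoint μ (Function.support (f i)) (Function.support (f j)))
    (s : Finset ι) (c : ι → 𝕜) :
    ‖∑ i ∈ s, c i • f i‖ ^ p.toReal = ∑ i ∈ s, ‖c i‖ ^ p.toReal := by
  have hr := ENNReal.toReal_pos h0 hp
  have key : ‖∑ i ∈ s, c i • f i‖ₑ ^ p.toReal = ∑ i ∈ s, ‖c i‖ₑ ^ p.toReal := by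
    rw [enorm_rpow_eq_lintegral h0 hp]
    have h1 : ∀ᵐ x ∂μ, ∀ i ∈ s, ∀ j ∈ s, i ≠ j → f i x = 0 ∨ f j x = 0 := by
      rw [Filter.eventually_all_finset]
      intro i _
      rw [Filter.eventually_all_finset]
      intro j _
      by_cases hij : i = j
      · simp [hij]
      have := measure_eq_zero_iff_ae_notMem.1 (hd hij)
      filter_upwards [this] with x hx _
      by_contra! h
      exact hx ⟨h.1, h.2⟩
    have h2 : ∀ᵐ x ∂μ, ∀ i ∈ s, (c i • f i : Lp 𝕜 p μ) x = c i • f i x := by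
      rw [Filter.eventually_all_finset]
      intro i _
      exact Lp.coeFn_smul (c i) (f i)
    calc ∫⁻ x, ‖(∑ i ∈ s, c i • f i : Lp 𝕜 p μ) x‖ₑ ^ p.toReal ∂μ
        = ∫⁻ x, ∑ i ∈ s, ‖(c i • f i : Lp 𝕜 p μ) x‖ₑ ^ p.toReal ∂μ := by
          apply lintegral_congr_ae
          filter_upwards [h1, h2, Lp.coeFn_finsetSum s fun i => c i • f i] with x hx1 hx2 hx3
          rw [hx3, Finset.sum_apply]
          refine enorm_sum_rpow_of_disjoint hr s _ fun i hi j hj hij => ?_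
          rw [hx2 i hi, hx2 j hj]
          rcases hx1 i hi j hj hij with h | h <;> simp [h]
      _ = ∑ i ∈ s, ∫⁻ x, ‖(c i • f i : Lp 𝕜 p μ) x‖ₑ ^ p.toReal ∂μ :=
          lintegral_finsetSum' _ fun i _ =>
            (Lp.aestronglyMeasurable (c i • f i)).enorm.pow_const _
      _ = ∑ i ∈ s, ‖c i‖ₑ ^ p.toReal := by
          refine Finset.sum_congr rfl fun i _ => ?_
          have : ‖f i‖ₑ = 1 := by rw [← ofReal_norm, hf i, ENNReal.ofReal_one]
          rw [← enorm_rpow_eq_lintegral h0 hp, enorm_smul, this, mul_one]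
  have := congrArg ENNReal.toReal key
  rw [ENNReal.toReal_sum fun i _ => by simp [hr.le]] at this
  simpa [← ENNReal.toReal_rpow] using this

variable (𝕜 : Type*) [RCLike 𝕜] [Fact (1 ≤ p)]

lemma sum_norm_restrict_rpow_le {A : Type*} (h0 : p ≠ 0) (hp : p ≠ ∞) {S : A → Set Ω}
    (hS : ∀ a, MeasurableSet (S a)) (hd : Pairwise fun a b => AEDisjoint μ (S a) (S b))
    (g : Lp 𝕜 p μ) (s : Finset A) :
    ∑ a ∈ s, ‖LpToLpRestrictCLM Ω 𝕜 𝕜 μ p (S a) g‖ ^ p.toReal ≤ ‖g‖ ^ p.toReal := by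
  have hr := ENNReal.toReal_pos h0 hp
  have key : ∑ a ∈ s, ‖LpToLpRestrictCLM Ω 𝕜 𝕜 μ p (S a) g‖ₑ ^ p.toReal ≤ ‖g‖ₑ ^ p.toReal := by
    calc ∑ a ∈ s, ‖LpToLpRestrictCLM Ω 𝕜 𝕜 μ p (S a) g‖ₑ ^ p.toReal
        = ∑ a ∈ s, ∫⁻ x in S a, ‖g x‖ₑ ^ p.toReal ∂μ := by
          refine Finset.sum_congr rfl fun a _ => ?_
          rw [enorm_rpow_eq_lintegral h0 hp]
          apply lintegral_congr_ae
          filter_upwards [LpToLpRestrictCLM_coeFn 𝕜 (S a) g] with x hx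
          rw [hx]
      _ = ∫⁻ x in ⋃ a ∈ s, S a, ‖g x‖ₑ ^ p.toReal ∂μ :=
          (lintegral_biUnion_finset₀ (fun a _ b _ hab => hd hab)
            (fun a _ => (hS a).nullMeasurableSet) _).symm
      _ ≤ ∫⁻ x, ‖g x‖ₑ ^ p.toReal ∂μ := setLIntegral_le_lintegral _ _
      _ = ‖g‖ₑ ^ p.toReal := (enorm_rpow_eq_lintegral h0 hp g).symm
  have := ENNReal.toReal_mono (by simp [hr.le]) key
  rw [ENNReal.toReal_sum fun i _ => by simp [hr.le]] at this
  simpa [← ENNReal.toReal_rpow] using this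

/-- Restriction of functions in `L_p(μ)` to the members of a family of pairwise almost everywhere
disjoint sets, as an operator into the `ℓ_p`-sum of the corresponding spaces. -/
lemma exists_restrict_to_lp {A : Type*} (h0 : p ≠ 0) (hp : p ≠ ∞) {S : A → Set Ω}
    (hS : ∀ a, MeasurableSet (S a)) (hd : Pairwise fun a b => AEDisjoint μ (S a) (S b)) :
    ∃ R : Lp 𝕜 p μ →L[𝕜] lp (fun a => Lp 𝕜 p (μ.restrict (S a))) p,
      ∀ g a, R g a = LpToLpRestrictCLM Ω 𝕜 𝕜 μ p (S a) g := by
  have hr := ENNReal.toReal_pos h0 hp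
  let R₀ : Lp 𝕜 p μ →ₗ[𝕜] lp (fun a => Lp 𝕜 p (μ.restrict (S a))) p :=
    { toFun := fun g => ⟨fun a => LpToLpRestrictCLM Ω 𝕜 𝕜 μ p (S a) g,
        memℓp_gen' (sum_norm_restrict_rpow_le 𝕜 h0 hp hS hd g)⟩
      map_add' := fun g h => by ext1; funext a; exact map_add _ g h
      map_smul' := fun c g => by ext1; funext a; exact map_smul _ c g }
  refine ⟨R₀.mkContinuous 1 fun g => ?_, fun g a => rfl⟩
  rw [one_mul]
  exact lp.norm_le_of_forall_sum_le hr (norm_nonneg _)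
    (sum_norm_restrict_rpow_le 𝕜 h0 hp hS hd g)

end MeasureTheory.Lp

/-! ### Isometric copies of `ℓ_p` -/

lemma lp.exists_linearIsometry {𝕜 ι E : Type*} [RCLike 𝕜] [NormedAddCommGroup E]
    [NormedSpace 𝕜 E] [CompleteSpace E] [DecidableEq ι] {p : ℝ≥0∞} [Fact (1 ≤ p)] (h0 : p ≠ 0)
    (hp : p ≠ ∞) (f : ι → E)
    (hf : ∀ (s : Finset ι) (c : ι → 𝕜),
      ‖∑ i ∈ s, c i • f i‖ ^ p.toReal = ∑ i ∈ s, ‖c i‖ ^ p.toReal) :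
    ∃ U : lp (fun _ : ι => 𝕜) p →ₗᵢ[𝕜] E, ∀ i, U (lp.single p i 1) = f i := by
  have hr := ENNReal.toReal_pos h0 hp
  have hn : ∀ (s : Finset ι) (c : ι → 𝕜),
      ‖∑ i ∈ s, c i • f i‖ = ‖∑ i ∈ s, lp.single (E := fun _ : ι => 𝕜) p i (c i)‖ := fun s c => by
    rw [← Real.rpow_left_inj (norm_nonneg _) (norm_nonneg _) hr.ne', hf,
      lp.norm_sum_single hr (E := fun _ : ι => 𝕜)]
  have hs : ∀ c : lp (fun _ : ι => 𝕜) p, Summable fun i => c i • f i := fun c => by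
    rw [summable_iff_vanishing_norm]
    intro ε hε
    obtain ⟨s, hs⟩ := summable_iff_vanishing_norm.1 (lp.hasSum_single hp c).summable ε hε
    exact ⟨s, fun t ht => by rw [hn]; exact hs t ht⟩
  let U₀ : lp (fun _ : ι => 𝕜) p →ₗ[𝕜] E :=
    { toFun := fun c => ∑' i, c i • f i
      map_add' := fun c d => by
        rw [← (hs c).tsum_add (hs d)]
        exact tsum_congr fun i => by rw [lp.coeFn_add, Pi.add_apply, add_smul]
      map_smul' := fun a c => by
        rw [RingHom.id_apply, ← (hs c).tsum_const_smul a]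
        exact tsum_congr fun i => by rw [lp.coeFn_smul, Pi.smul_apply, smul_assoc] }
  refine ⟨⟨U₀, fun c => ?_⟩, fun i => ?_⟩
  · refine tendsto_nhds_unique ((hs c).hasSum.norm) ?_
    simp_rw [hn]
    exact (lp.hasSum_single hp c).norm
  · change ∑' j, _ = _
    rw [tsum_eq_single i fun j hj =>
        (congrArg (· • f j) (lp.single_apply_ne (E := fun _ : ι => 𝕜) p i 1 hj)).trans
          (zero_smul 𝕜 _),
      lp.single_apply_self, one_smul]

/-- Normalized disjointly supported functions span an isometric copy of `ℓ_p` in `L_p(μ)`, and the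
coordinate functionals extend to an operator on `L_p(μ)`. -/
lemma MeasureTheory.Lp.exists_linearIsometry_leftInverse {𝕜 ι Ω : Type*} [RCLike 𝕜]
    [DecidableEq ι] [MeasurableSpace Ω]
    {μ : Measure Ω} {p : ℝ≥0∞} [Fact (1 ≤ p)] (h0 : p ≠ 0) (hp : p ≠ ∞)
    (f : ι → Lp 𝕜 p μ) (hf : ∀ i, ‖f i‖ = 1)
    (hd : Pairwise fun i j => AEDisjoint μ (Function.support (f i)) (Function.support (f j))) :
    ∃ (U : lp (fun _ : ι => 𝕜) p →ₗᵢ[𝕜] Lp 𝕜 p μ) (V : Lp 𝕜 p μ →L[𝕜] lp (fun _ : ι => 𝕜) p),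
      (∀ i, U (lp.single p i 1) = f i) ∧ ∀ c, V (U c) = c := by
  have hr := ENNReal.toReal_pos h0 hp
  obtain ⟨U, hU⟩ := lp.exists_linearIsometry h0 hp f
    (Lp.norm_sum_smul_rpow_of_aedisjoint h0 hp f hf hd)
  let S : ι → Set Ω := fun i => Function.support (f i)
  have hS : ∀ i, MeasurableSet (S i) := fun i => (Lp.stronglyMeasurable (f i)).measurableSet_support
  obtain ⟨R, hR⟩ := Lp.exists_restrict_to_lp (p := p) 𝕜 h0 hp hS hd
  have hfi : ∀ i, ‖R (f i) i‖ = 1 := fun i => by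
    have hr' := hr.ne'
    have : ‖R (f i) i‖ₑ ^ p.toReal = ‖f i‖ₑ ^ p.toReal := by
      rw [hR, Lp.enorm_rpow_eq_lintegral h0 hp, Lp.enorm_rpow_eq_lintegral h0 hp]
      calc _ = ∫⁻ x in S i, ‖f i x‖ₑ ^ p.toReal ∂μ := by
            apply lintegral_congr_ae
            filter_upwards [LpToLpRestrictCLM_coeFn 𝕜 (S i) (f i)] with x hx
            rw [hx]
        _ = _ := setLIntegral_eq_of_support_subset fun x hx => by
            by_contra h
            exact hx (by simp [Function.notMem_support.1 h, hr])
    rw [← hf i, ← toReal_enorm, ← toReal_enorm,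
      (ENNReal.rpow_left_injective hr').eq_iff.1 this]
  have hfij : ∀ i j, i ≠ j → R (f i) j = 0 := fun i j hij => by
    rw [hR]
    ext1
    have h1 : ∀ᵐ x ∂μ.restrict (S j), x ∉ S i := by
      rw [ae_restrict_iff' (hS j)]
      filter_upwards [measure_eq_zero_iff_ae_notMem.1 (hd hij)] with x hx hxj hxi
      exact hx ⟨hxi, hxj⟩
    filter_upwards [LpToLpRestrictCLM_coeFn 𝕜 (S j) (f i), h1,
      Lp.coeFn_zero 𝕜 p (μ.restrict (S j))] with x hx hx1 hx0
    rw [hx, hx0, Function.notMem_support.1 hx1, Pi.zero_apply]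
  -- Hahn–Banach functionals norming each `f i` on its own support; having norm at most one, they
  -- act coordinatewise on the `ℓ_p`-sum.
  choose φ hφ1 hφ2 using fun i => exists_dual_vector'' 𝕜 (R (f i) i)
  have hφ : ∀ i v, ‖φ i v‖ ≤ ‖v‖ := fun i v => by
    simpa using (φ i).le_of_opNorm_le (hφ1 i) v
  have hsum : ∀ (v : lp (fun i => Lp 𝕜 p (μ.restrict (S i))) p) (s : Finset ι),
      ∑ i ∈ s, ‖φ i (v i)‖ ^ p.toReal ≤ ‖v‖ ^ p.toReal := fun v s =>
    (Finset.sum_le_sum fun i _ => Real.rpow_le_rpow (norm_nonneg _) (hφ i _) hr.le).trans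
      (lp.sum_rpow_le_norm_rpow hr v s)
  let Φ₀ : lp (fun i => Lp 𝕜 p (μ.restrict (S i))) p →ₗ[𝕜] lp (fun _ : ι => 𝕜) p :=
    { toFun := fun v => ⟨fun i => φ i (v i), memℓp_gen' (hsum v)⟩
      map_add' := fun v w => by ext1; funext i; exact map_add (φ i) (v i) (w i)
      map_smul' := fun c v => by ext1; funext i; exact map_smul (φ i) c (v i) }
  let Φ := Φ₀.mkContinuous 1 fun v => by
    rw [one_mul]; exact lp.norm_le_of_forall_sum_le hr (norm_nonneg _) (hsum v)
  have hVf : ∀ i, Φ (R (f i)) = lp.single p i 1 := fun i => by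
    ext1; funext j
    change φ j (R (f i) j) = _
    by_cases hij : i = j
    · subst hij
      rw [lp.single_apply_self, hφ2, hfi, RCLike.ofReal_one]
    · rw [hfij i j hij, map_zero]
      exact (lp.single_apply_ne (E := fun _ : ι => 𝕜) p i 1 (Ne.symm hij)).symm
  refine ⟨U, Φ.comp R, hU, fun c => ?_⟩
  have h1 := ((lp.hasSum_single hp c).mapL U.toContinuousLinearMap).mapL (Φ.comp R)
  refine h1.unique ?_
  convert lp.hasSum_single hp c using 2 with i
  have : lp.single (E := fun _ : ι => 𝕜) p i (c i) = c i • lp.single p i 1 := by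
    rw [← lp.single_smul, smul_eq_mul, mul_one]
  rw [this, map_smul, map_smul]
  congr 1
  change Φ (R (U _)) = _
  rw [hU, hVf]

/-! ### Operators from `ℓ_p` into an `ℓ_p`-sum of few spaces over finite measures -/

/-- By the parallelogram law the larger of `‖w + v‖ ^ 2` and `‖w - v‖ ^ 2` is at least their mean
`‖w‖ ^ 2 + ‖v‖ ^ 2`, so signs can be chosen greedily. -/
lemma exists_norm_one_sum_sq_norm_le {𝕜 ι H : Type*} [RCLike 𝕜] [NormedAddCommGroup H]
    [InnerProductSpace 𝕜 H] (s : Finset ι) (v : ι → H) :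
    ∃ ε : ι → 𝕜, (∀ i, ‖ε i‖ = 1) ∧ ∑ i ∈ s, ‖v i‖ ^ 2 ≤ ‖∑ i ∈ s, ε i • v i‖ ^ 2 := by
  classical
  induction s using Finset.induction_on with
  | empty => exact ⟨fun _ => 1, by simp, by simp⟩
  | insert a s ha ih =>
    obtain ⟨ε, hε, h⟩ := ih
    set w := ∑ i ∈ s, ε i • v i with hw
    obtain ⟨η, hη, h'⟩ : ∃ η : 𝕜, ‖η‖ = 1 ∧ ‖v a‖ ^ 2 + ‖w‖ ^ 2 ≤ ‖η • v a + w‖ ^ 2 := by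
      have hpar := parallelogram_law_with_norm 𝕜 w (v a)
      rcases le_total ‖w - v a‖ ‖w + v a‖ with hle | hle
      · refine ⟨1, by simp, ?_⟩
        rw [one_smul, add_comm (v a) w]
        nlinarith [norm_nonneg (w - v a)]
      · refine ⟨-1, by simp, ?_⟩
        rw [neg_one_smul, neg_add_eq_sub]
        nlinarith [norm_nonneg (w + v a)]
    refine ⟨Function.update ε a η, fun i => ?_, ?_⟩
    · by_cases hi : i = a
      · subst hi; simpa using hη
      · simpa [hi] using hε i
    · have hs : ∑ i ∈ s, Function.update ε a η i • v i = w :=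
        Finset.sum_congr rfl fun i hi => by
          rw [Function.update_of_ne (ne_of_mem_of_not_mem hi ha)]
      rw [Finset.sum_insert ha, Finset.sum_insert ha, hs, Function.update_self]
      linarith

/-- A signed sum of `n` such unit vectors has norm `n ^ (1 / p)`, while its image can be given
squared norm at least `n * δ ^ 2`. Since `2 / p < 1`, this bounds `n`. -/
lemma lp.finite_setOf_le_norm_map_single {𝕜 ι H : Type*} [RCLike 𝕜] [DecidableEq ι]
    [NormedAddCommGroup H] [InnerProductSpace 𝕜 H] {p : ℝ≥0∞} [Fact (1 ≤ p)] (hp2 : 2 < p)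
    (hp : p ≠ ∞) (B : lp (fun _ : ι => 𝕜) p →L[𝕜] H) {δ : ℝ} (hδ : 0 < δ) :
    {i | δ ≤ ‖B (lp.single p i 1)‖}.Finite := by
  have hr2 : 2 < p.toReal := by
    simpa using (ENNReal.toReal_lt_toReal (by simp) hp).2 hp2
  have hr : 0 < p.toReal := by linarith
  by_contra hinf
  have hexp : 0 < 1 - 2 / p.toReal := by
    rw [sub_pos, div_lt_one hr]; exact hr2
  have hbound : ∀ n : ℕ, 0 < n → (n : ℝ) ^ (1 - 2 / p.toReal) ≤ ‖B‖ ^ 2 / δ ^ 2 := fun n hn => by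
    obtain ⟨t, hts, htn⟩ := Set.Infinite.exists_subset_card_eq hinf n
    obtain ⟨ε, hε, h⟩ := exists_norm_one_sum_sq_norm_le (𝕜 := 𝕜) t fun i => B (lp.single p i 1)
    set z : lp (fun _ : ι => 𝕜) p := ∑ i ∈ t, lp.single p i (ε i) with hz
    have hBz : B z = ∑ i ∈ t, ε i • B (lp.single p i 1) := by
      rw [hz, map_sum]
      refine Finset.sum_congr rfl fun i _ => ?_
      rw [← map_smul, ← lp.single_smul, smul_eq_mul, mul_one]
    have hzn : ‖z‖ ^ p.toReal = n := by
      rw [hz, lp.norm_sum_single hr (E := fun _ : ι => 𝕜)]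
      simp [hε, htn]
    have hz2 : ‖z‖ ^ 2 = (n : ℝ) ^ (2 / p.toReal) := by
      rw [← hzn, ← Real.rpow_mul (norm_nonneg _), mul_div_cancel₀ _ hr.ne', Real.rpow_two]
    have h1 : n * δ ^ 2 ≤ ‖B‖ ^ 2 * (n : ℝ) ^ (2 / p.toReal) := by
      calc n * δ ^ 2 = ∑ i ∈ t, δ ^ 2 := by simp [htn]
        _ ≤ ∑ i ∈ t, ‖B (lp.single p i 1)‖ ^ 2 :=
            Finset.sum_le_sum fun i hi => pow_le_pow_left₀ hδ.le (hts hi) 2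
        _ ≤ ‖B z‖ ^ 2 := by rw [hBz]; exact h
        _ ≤ (‖B‖ * ‖z‖) ^ 2 := pow_le_pow_left₀ (norm_nonneg _) (B.le_opNorm z) 2
        _ = _ := by rw [mul_pow, hz2]
    have hn' : (0 : ℝ) < n := by exact_mod_cast hn
    rw [Real.rpow_sub hn', Real.rpow_one, div_le_div_iff₀ (by positivity) (by positivity)]
    exact h1
  have htend := (tendsto_rpow_atTop hexp).comp tendsto_natCast_atTop_atTop
  obtain ⟨n, hn, hn0⟩ := ((htend.eventually_gt_atTop (‖B‖ ^ 2 / δ ^ 2)).and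
    (Filter.eventually_gt_atTop 0)).exists
  exact absurd (hbound n hn0) (not_le.2 hn)

lemma lp.countable_setOf_map_single_ne_zero {𝕜 ι H : Type*} [RCLike 𝕜] [DecidableEq ι]
    [NormedAddCommGroup H] [InnerProductSpace 𝕜 H] {p : ℝ≥0∞} [Fact (1 ≤ p)] (hp2 : 2 < p)
    (hp : p ≠ ∞) (B : lp (fun _ : ι => 𝕜) p →L[𝕜] H) :
    {i | B (lp.single p i 1) ≠ 0}.Countable := by
  refine (Set.countable_iUnion fun n : ℕ => (lp.finite_setOf_le_norm_map_single hp2 hp B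
    (Nat.one_div_pos_of_nat (α := ℝ) (n := n))).countable).mono fun i hi => ?_
  obtain ⟨n, hn⟩ := exists_nat_one_div_lt (norm_pos_iff.2 hi)
  exact Set.mem_iUnion.2 ⟨n, hn.le⟩

lemma MeasureTheory.Lp.exists_injective_of_exponent_le {𝕜 Ω : Type*} [RCLike 𝕜]
    [MeasurableSpace Ω] (ν : Measure Ω) [IsFiniteMeasure ν] {p q : ℝ≥0∞} [Fact (1 ≤ p)]
    [Fact (1 ≤ q)] (hpq : p ≤ q) :
    ∃ J : Lp 𝕜 q ν →L[𝕜] Lp 𝕜 p ν, Function.Injective J := by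
  let J₀ : Lp 𝕜 q ν →ₗ[𝕜] Lp 𝕜 p ν :=
    { toFun := fun f => ⟨f.1, Lp.antitone hpq f.2⟩
      map_add' := fun f g => rfl
      map_smul' := fun c f => rfl }
  refine ⟨J₀.mkContinuous (ν Set.univ ^ (1 / p.toReal - 1 / q.toReal)).toReal fun f => ?_,
    fun f g h => ?_⟩
  · have hexp : 0 ≤ 1 / p.toReal - 1 / q.toReal := by
      rcases eq_or_ne q ∞ with rfl | hq
      · simp
      have hp0 : 0 < p.toReal := ENNReal.toReal_pos
        (zero_lt_one.trans_le (Fact.out : 1 ≤ p)).ne' (ne_top_of_le_ne_top hq hpq)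
      rw [sub_nonneg]
      exact one_div_le_one_div_of_le hp0 (ENNReal.toReal_mono hq hpq)
    have hfin : ν Set.univ ^ (1 / p.toReal - 1 / q.toReal) ≠ ∞ :=
      ENNReal.rpow_ne_top_of_nonneg hexp (measure_ne_top ν _)
    rw [mul_comm, Lp.norm_def, Lp.norm_def, ← ENNReal.toReal_mul]
    exact ENNReal.toReal_mono (ENNReal.mul_ne_top (Lp.eLpNorm_ne_top f) hfin)
      (eLpNorm_le_eLpNorm_mul_rpow_measure_univ hpq (Lp.aestronglyMeasurable f))
  · exact Subtype.ext (congrArg (fun v : Lp 𝕜 p ν => v.1) h)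

/-- No operator from `ℓ_p(ι)`, `2 < p < ∞`, into an `L_p(κ)` space with `κ < #ι` is injective. -/
lemma IsLpCardSpace.not_injective {𝕜 : Type*} [RCLike 𝕜] {p : ℝ≥0∞} [Fact (1 ≤ p)]
    (hp2 : 2 < p) (hp : p ≠ ∞) {ι : Type u} {κ : Cardinal.{u}} (hκ : ℵ₀ ≤ κ) (hκι : κ < #ι)
    {Y : Type*} [NormedAddCommGroup Y] [NormedSpace 𝕜 Y] (hY : IsLpCardSpace 𝕜 p κ Y)
    (W : lp (fun _ : ι => 𝕜) p →L[𝕜] Y) : ¬ Function.Injective W := by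
  classical
  intro hW
  obtain ⟨A, Ω, m, μ, hA, hμ, ⟨e⟩⟩ := hY
  choose J hJ using fun a => Lp.exists_injective_of_exponent_le (𝕜 := 𝕜) (μ a) hp2.le
  let B : ∀ a, lp (fun _ : ι => 𝕜) p →L[𝕜] Lp 𝕜 2 (μ a) := fun a =>
    (J a).comp ((lp.evalCLM 𝕜 (fun a => Lp 𝕜 p (μ a)) p a).comp
      (e.toContinuousLinearEquiv.toContinuousLinearMap.comp W))
  let N : A → Set ι := fun a => {i | B a (lp.single p i 1) ≠ 0}
  have hN : ∀ a, #(N a) ≤ ℵ₀ := fun a =>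
    (lp.countable_setOf_map_single_ne_zero hp2 hp (B a)).le_aleph0
  have huniv : ⋃ a, N a = Set.univ := by
    refine Set.eq_univ_of_forall fun i => ?_
    by_contra hi
    have hi' : ∀ a, B a (lp.single p i 1) = 0 := fun a => by
      by_contra h
      exact hi (Set.mem_iUnion.2 ⟨a, h⟩)
    have h1 : e (W (lp.single p i 1)) = 0 := by
      ext1
      funext a
      exact hJ a ((hi' a).trans (map_zero (J a)).symm)
    have h2 : lp.single (E := fun _ : ι => 𝕜) p i 1 = 0 :=
      hW ((e.map_eq_zero_iff.1 h1).trans (map_zero W).symm)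
    have h3 := lp.norm_single (E := fun _ : ι => 𝕜) (zero_lt_two.trans hp2) i 1
    rw [h2] at h3
    simp at h3
  have hle : #ι ≤ κ := by
    calc #ι = #(⋃ a, N a) := by rw [huniv, Cardinal.mk_univ]
      _ ≤ Cardinal.sum fun a => #(N a) := Cardinal.mk_iUnion_le_sum_mk
      _ ≤ Cardinal.sum fun _ : A => ℵ₀ := Cardinal.sum_le_sum _ _ hN
      _ = #A * ℵ₀ := by simp
      _ ≤ κ * κ := mul_le_mul' hA hκ
      _ = κ := Cardinal.mul_eq_self hκ
  exact absurd hκι (not_lt.2 hle)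

/-! ### Large disjoint families -/

lemma MeasureTheory.Lp.aedisjoint_support_of_restrict_eq_zero {𝕜 Ω : Type*} [RCLike 𝕜]
    [MeasurableSpace Ω] {μ : Measure Ω} {p : ℝ≥0∞} [Fact (1 ≤ p)] {S : Set Ω}
    (hS : MeasurableSet S) (g : Lp 𝕜 p μ) (hg : LpToLpRestrictCLM Ω 𝕜 𝕜 μ p S g = 0) :
    AEDisjoint μ (Function.support g) S := by
  have h1 : ∀ᵐ x ∂μ.restrict S, g x = 0 := by
    have h2 := LpToLpRestrictCLM_coeFn 𝕜 S g
    rw [hg] at h2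
    filter_upwards [h2, Lp.coeFn_zero 𝕜 p (μ.restrict S)] with x hx hx0
    rw [← hx, hx0, Pi.zero_apply]
  rw [ae_restrict_iff' hS] at h1
  refine measure_eq_zero_iff_ae_notMem.2 ?_
  filter_upwards [h1] with x hx hxm
  exact hxm.1 (hx hxm.2)

/-- A family of pairwise disjointly supported functions in `L_p(μ)` gives an operator on `L_p(μ)`
into an `L_p(κ)` space whose kernel consists of functions disjoint from the family. -/
lemma MeasureTheory.Lp.exists_isLpCardSpace_of_aedisjoint {𝕜 : Type} [RCLike 𝕜] {Ω : Type u}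
    [MeasurableSpace Ω] {μ : Measure Ω} {p : ℝ≥0∞} [Fact (1 ≤ p)] (h0 : p ≠ 0) (hp : p ≠ ∞)
    (F : Set (Lp 𝕜 p μ))
    (hF : F.Pairwise fun f g => AEDisjoint μ (Function.support f) (Function.support g))
    {κ : Cardinal.{u}} (hκ : ℵ₀ ≤ κ) (hFκ : #F ≤ κ) :
    ∃ (Y : Type u) (_ : NormedAddCommGroup Y) (_ : NormedSpace 𝕜 Y), IsLpCardSpace 𝕜 p κ Y ∧
      ∃ R : Lp 𝕜 p μ →L[𝕜] Y, ∀ g, R g = 0 →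
        ∀ f ∈ F, AEDisjoint μ (Function.support g) (Function.support f) := by
  -- Dyadic level sets: they exhaust each support, and `|f| ≥ 2 ^ n` on a piece forces finite
  -- measure for `f` in `L_p`. Countably many pieces per function keep the cardinality within `κ`.
  let S : F × ℤ → Set Ω := fun a =>
    {x | ‖(a.1 : Lp 𝕜 p μ) x‖₊ ∈ Set.Ico ((2 : NNReal) ^ a.2) (2 ^ (a.2 + 1))}
  have hS : ∀ a, MeasurableSet (S a) := fun a =>
    (Lp.stronglyMeasurable a.1.1).nnnorm.measurable measurableSet_Ico
  have hsub : ∀ a, S a ⊆ Function.support a.1.1 := fun a x hx =>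
    nnnorm_ne_zero_iff.1 (lt_of_lt_of_le (zpow_pos two_pos a.2) hx.1).ne'
  have hunion : ∀ f : F, Function.support f.1 ⊆ ⋃ n : ℤ, S (f, n) := fun f x hx => by
    obtain ⟨n, hn⟩ := NNReal.exists_mem_Ico_zpow (nnnorm_ne_zero_iff.2 hx) one_lt_two
    exact Set.mem_iUnion.2 ⟨n, hn⟩
  have hd : Pairwise fun a b => AEDisjoint μ (S a) (S b) := by
    rintro ⟨f, m⟩ ⟨g, n⟩ hne
    by_cases hfg : f = g
    · subst hfg
      have hmn : m ≠ n := fun h => hne (by rw [h])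
      refine Disjoint.aedisjoint (Set.disjoint_left.2 fun x hx hx' => hmn ?_)
      have h1 : m < n + 1 := (zpow_lt_zpow_iff_right₀ (one_lt_two (α := NNReal))).1
        (hx.1.trans_lt hx'.2)
      have h2 : n < m + 1 := (zpow_lt_zpow_iff_right₀ (one_lt_two (α := NNReal))).1
        (hx'.1.trans_lt hx.2)
      omega
    · exact (hF f.2 g.2 fun h => hfg (Subtype.ext h)).mono (hsub _) (hsub _)
  have hfin : ∀ a, IsFiniteMeasure (μ.restrict (S a)) := fun a => by
    refine ⟨?_⟩
    rw [Measure.restrict_apply_univ]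
    exact (measure_mono fun x hx => hx.1).trans_lt
      ((Lp.memLp a.1.1).meas_ge_lt_top h0 hp (ε := 2 ^ a.2) (by positivity))
  obtain ⟨R, hR⟩ := Lp.exists_restrict_to_lp (p := p) 𝕜 h0 hp hS hd
  refine ⟨_, inferInstance, inferInstance, ⟨F × ℤ, fun _ => Ω, fun _ => inferInstance,
    fun a => μ.restrict (S a), ?_, hfin, ⟨LinearIsometryEquiv.refl 𝕜 _⟩⟩, R,
    fun g hg f hf => ?_⟩
  · rw [Cardinal.mk_prod]
    simpa using mul_le_mul' hFκ hκ |>.trans (Cardinal.mul_eq_self hκ).le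
  · refine AEDisjoint.mono ?_ le_rfl (hunion ⟨f, hf⟩)
    rw [AEDisjoint.iUnion_right_iff]
    intro n
    refine Lp.aedisjoint_support_of_restrict_eq_zero (hS _) g ?_
    rw [← hR, hg]
    rfl

lemma MeasureTheory.Lp.exists_aedisjoint_family {𝕜 : Type} [RCLike 𝕜] {Ω : Type u}
    [MeasurableSpace Ω] {μ : Measure Ω} {p : ℝ≥0∞} [Fact (1 ≤ p)] (h0 : p ≠ 0) (hp : p ≠ ∞)
    (X : Submodule 𝕜 (Lp 𝕜 p μ)) {ι : Type u} (hι : ℵ₀ < #ι)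
    (hX : ¬ ∃ κ : Cardinal.{u}, ℵ₀ ≤ κ ∧ κ < #ι ∧
      ∃ (Y : Type u) (_ : NormedAddCommGroup Y) (_ : NormedSpace 𝕜 Y),
        IsLpCardSpace 𝕜 p κ Y ∧ ∃ T : X →L[𝕜] Y, Function.Injective T) :
    ∃ f : ι → Lp 𝕜 p μ, (∀ i, f i ∈ X) ∧ (∀ i, ‖f i‖ = 1) ∧
      Pairwise fun i j => AEDisjoint μ (Function.support (f i)) (Function.support (f j)) := by
  obtain ⟨F, hF⟩ := zorn_subset {F : Set (Lp 𝕜 p μ) | (∀ f ∈ F, f ∈ X ∧ ‖f‖ = 1) ∧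
      F.Pairwise fun f g => AEDisjoint μ (Function.support f) (Function.support g)} <| by
    intro c hc hchain
    refine ⟨⋃₀ c, ⟨?_, ?_⟩, fun s hs => Set.subset_sUnion_of_mem hs⟩
    · rintro f ⟨s, hs, hfs⟩
      exact (hc hs).1 f hfs
    · rw [Set.pairwise_sUnion hchain.directedOn]
      exact fun s hs => (hc hs).2
  obtain ⟨hF1, hF2⟩ := hF.prop
  have hcard : #ι ≤ #F := by
    by_contra! hlt
    -- The maximum with `ℵ₀` makes `κ` infinite; it stays below `#ι` because `ι` is uncountable.
    obtain ⟨Y, _, _, hY, R, hR⟩ := Lp.exists_isLpCardSpace_of_aedisjoint h0 hp F hF2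
      (le_max_left ℵ₀ #F) (le_max_right _ _)
    refine hX ⟨_, le_max_left _ _, max_lt hι hlt, Y, _, _, hY, R.comp X.subtypeL, ?_⟩
    rw [injective_iff_map_eq_zero]
    rintro ⟨g, hgX⟩ hg
    by_contra hne
    have hg0 : g ≠ 0 := fun h => hne (Subtype.ext h)
    set g' : Lp 𝕜 p μ := ((‖g‖⁻¹ : ℝ) : 𝕜) • g with hg'
    have hg'1 : ‖g'‖ = 1 := by
      rw [hg', norm_smul, RCLike.norm_ofReal, abs_of_nonneg (by positivity),
        inv_mul_cancel₀ (norm_ne_zero_iff.2 hg0)]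
    have hRg' : R g' = 0 := by
      rw [hg', map_smul]
      have : R g = 0 := hg
      rw [this, smul_zero]
    have hdis := hR g' hRg'
    -- Disjoint from all of `F`, `g'` lies in `F` by maximality, hence is disjoint from itself and
    -- vanishes.
    have hmem : g' ∈ F := by
      refine hF.le_of_ge (y := insert g' F) ⟨?_, ?_⟩ (Set.subset_insert _ _)
        (Set.mem_insert _ _)
      · rintro f (rfl | hf)
        · exact ⟨X.smul_mem _ hgX, hg'1⟩
        · exact hF1 f hf
      · exact hF2.insert fun f hf _ => ⟨hdis f hf, (hdis f hf).symm⟩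
    have hz : g' = 0 := by
      rw [Lp.eq_zero_iff_ae_eq_zero]
      have := hdis g' hmem
      rw [AEDisjoint, Set.inter_self] at this
      filter_upwards [measure_eq_zero_iff_ae_notMem.1 this] with x hx
      exact Function.notMem_support.1 hx
    rw [hz, norm_zero] at hg'1
    exact zero_ne_one hg'1
  obtain ⟨j⟩ := hcard
  exact ⟨fun i => (j i : Lp 𝕜 p μ), fun i => (hF1 _ (j i).2).1, fun i => (hF1 _ (j i).2).2,
    fun a b hab => hF2 (j a).2 (j b).2 fun h => hab (j.injective (Subtype.ext h))⟩


theorem proposition2 {𝕜 : Type} [RCLike 𝕜] (p : ℝ≥0∞) [Fact (1 ≤ p)] (hp2 : 2 < p) (hp : p ≠ ∞)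
    {Ω : Type u} [MeasurableSpace Ω] (μ : Measure Ω)
    (X : Submodule 𝕜 (Lp 𝕜 p μ)) (hX : IsClosed (X : Set (Lp 𝕜 p μ)))
    (ι : Type u) (hι : ℵ₀ < #ι) :
    List.TFAE
      [ -- `ℓ_p(ι)` isometrically embeds into `X`
        Nonempty (lp (fun _ : ι => 𝕜) p →ₗᵢ[𝕜] X),
        -- some subspace of `X` is isomorphic to `ℓ_p(ι)` and complemented in `L_p(μ)`
        ∃ Z : Submodule 𝕜 (Lp 𝕜 p μ), Z ≤ X ∧
          Nonempty (lp (fun _ : ι => 𝕜) p ≃L[𝕜] Z) ∧ Z.ClosedComplemented,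
        -- `ℓ_p(ι)` isomorphically embeds into `X`
        ∃ T : lp (fun _ : ι => 𝕜) p →L[𝕜] X, ∃ c : ℝ, 0 < c ∧ ∀ x, c * ‖x‖ ≤ ‖T x‖,
        -- no injective operator from `X` into an `L_p(κ)` space with `κ < #ι`
        ¬ ∃ κ : Cardinal.{u}, ℵ₀ ≤ κ ∧ κ < #ι ∧
          ∃ (Y : Type u) (_ : NormedAddCommGroup Y) (_ : NormedSpace 𝕜 Y),
            IsLpCardSpace 𝕜 p κ Y ∧ ∃ T : X →L[𝕜] Y, Function.Injective T ] :=
 by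
  classical
  have h0 : p ≠ 0 := (zero_lt_two.trans hp2).ne'
  have : CompleteSpace X := hX.completeSpace_coe
  tfae_have 1 → 3 := by
    rintro ⟨U⟩
    exact ⟨U.toContinuousLinearMap, 1, one_pos, fun x => by
      rw [one_mul]; exact (U.norm_map x).ge⟩
  tfae_have 2 → 3 := by
    rintro ⟨Z, hZX, ⟨e⟩, -⟩
    refine ⟨(Z.subtypeL.comp e.toContinuousLinearMap).codRestrict X fun x => hZX (e x).2,
      (‖e.symm.toContinuousLinearMap‖ + 1)⁻¹, by positivity, fun x => ?_⟩
    rw [inv_mul_le_iff₀ (by positivity)]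
    have h := e.symm.toContinuousLinearMap.le_opNorm (e x)
    simp only [ContinuousLinearEquiv.coe_coe, ContinuousLinearEquiv.symm_apply_apply] at h
    refine h.trans ?_
    change _ ≤ _ * ‖e x‖
    gcongr
    linarith
  tfae_have 3 → 4 := by
    rintro ⟨T, c, hc, hT⟩ ⟨κ, hκ, hκι, Y, _, _, hY, W, hW⟩
    have hTinj : Function.Injective T := by
      rw [injective_iff_map_eq_zero]
      intro x hx
      have h := hT x
      rw [hx, norm_zero] at h
      exact norm_le_zero_iff.1 (nonpos_of_mul_nonpos_right h hc)
    exact hY.not_injective hp2 hp hκ hκι (W.comp T) (hW.comp hTinj)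
  have key (h4 : ¬ ∃ κ : Cardinal.{u}, ℵ₀ ≤ κ ∧ κ < #ι ∧
      ∃ (Y : Type u) (_ : NormedAddCommGroup Y) (_ : NormedSpace 𝕜 Y),
        IsLpCardSpace 𝕜 p κ Y ∧ ∃ T : X →L[𝕜] Y, Function.Injective T) :
      ∃ (U : lp (fun _ : ι => 𝕜) p →ₗᵢ[𝕜] Lp 𝕜 p μ)
        (V : Lp 𝕜 p μ →L[𝕜] lp (fun _ : ι => 𝕜) p), (∀ c, U c ∈ X) ∧ ∀ c, V (U c) = c := by
    obtain ⟨f, hfX, hf1, hfd⟩ := Lp.exists_aedisjoint_family h0 hp X hι h4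
    obtain ⟨U, V, hU, hVU⟩ := Lp.exists_linearIsometry_leftInverse h0 hp f hf1 hfd
    refine ⟨U, V, fun c => ?_, hVU⟩
    -- Closedness of `X` captures the limits of finite combinations of the `f i`.
    refine hX.mem_of_tendsto ((lp.hasSum_single hp c).mapL U.toContinuousLinearMap)
      (Filter.Eventually.of_forall fun s => X.sum_mem fun i _ => ?_)
    have : lp.single (E := fun _ : ι => 𝕜) p i (c i) = c i • lp.single p i 1 := by
      rw [← lp.single_smul, smul_eq_mul, mul_one]
    rw [this, map_smul]
    refine X.smul_mem _ ?_
    change U _ ∈ X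
    rw [hU]
    exact hfX i
  tfae_have 4 → 1 := by
    intro h4
    obtain ⟨U, V, hUX, -⟩ := key h4
    exact ⟨⟨U.toLinearMap.codRestrict X hUX, U.norm_map⟩⟩
  tfae_have 4 → 2 := by
    intro h4
    obtain ⟨U, V, hUX, hVU⟩ := key h4
    -- Since `V ∘ U = id`, `U ∘ V` is a projection onto the range of `U`.
    refine ⟨LinearMap.range U.toLinearMap, ?_, ⟨U.equivRange.toContinuousLinearEquiv⟩,
      (U.toContinuousLinearMap.comp V).codRestrict _ fun g => ⟨V g, rfl⟩, ?_⟩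
    · rintro _ ⟨c, rfl⟩
      exact hUX c
    · rintro ⟨_, c, rfl⟩
      exact Subtype.ext (congrArg U (hVU c))
  tfae_finish
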